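/- For integers $m\ge 0$ and $d\ge 1$, let $U_{m,d}$ be the uniform matroid of rank $d$ on $m+d$ elements, with its natural action of the symmetric group $S_{m+d}$. Let $OS_{m,d,p}$ be the degree $p$ part of its Orlik–Solomon algebra over $\mathbb{C}$ (the exterior algebra on generators $e_i$ indexed by the elements of the matroid, modulo the ideal generated by the elements $\partial(e_{i_1}\cdots e_{i_k})$ for all circuits $\{i_1,\ldots,i_k\}$), regarded as a representation of $S_{m+d}$. The equivariant characteristic polynomial of $U_{m,d}$ is $$H_{m,d}(t)=\sum_{p=0}^{d}(-1)^p\,t^{d-p}\,OS_{m,d,p},$$ a polynomial in $t$ whose coefficients are virtual representations of $S_{m+d}$. Let $\Lambda$ be the ring of symmetric functions, and let $\operatorname{ch}$ denote the Frobenius characteristic, $\operatorname{ch}(V)=\frac1{n!}\sum_{w\in S_n}\chi_V(w)\,p_{\rho(w)}\in\Lambda$ for a virtual representation $V$ of $S_n$, where $p_{\rho(w)}$ is the power sum symmetric function indexed by the cycle type of $w$; it is applied to polynomials in $t$ coefficient by coefficient. In $\Lambda[[t,u,x]]$ put $$\mathcal{H}(t,u,x)=\sum_{d=1}^{\infty}\sum_{m=0}^{\infty}\operatorname{ch}\big(H_{m,d}(t)\big)\,u^d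 x^m .$$ Let $s[n]$ be the Schur function of the one-row partition $(n)$, that is, the Frobenius characteristic of the trivial representation of $S_n$, and let $s(y)=\sum_{n=0}^\infty s[n]\,y^n$. Then, in the field of fractions of $\Lambda[[t,u,x]]$, $$\mathcal{H}(t,u,x)=\frac{u}{u-x}\left(-1+\frac{s(x)}{s(u)}\right)+\frac{tu}{tu-x}\left(\frac{s(tu)}{s(u)}-\frac{s(x)}{s(u)}\right)$$ and $$1+\mathcal{H}(t,u,0)=\frac{s(tu)}{s(u)} .$$ -/

import Mathlib

open scoped Polynomial

noncomputable section

namespace EqKL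

/-! ## Virtual representations -/

/-- The ring `VRep(W)` of virtual finite-dimensional complex representations of `W`. A virtual
representation is identified with its character, so this is the ring of virtual characters: the
subring of functions `W → ℂ` generated by the characters of the finite-dimensional complex
representations. (Sums and products of characters are the characters of direct sums and tensor
products, so its elements are the differences of two characters.) -/
def VRep (W : Type) [Group W] : Subring (W → ℂ) :=
  Subring.closure {χ | ∃ (V : Type) (_ : AddCommGroup V) (_ : Module ℂ V)
    (_ : FiniteDimensional ℂ V) (ρ : Representation ℂ W V), χ = ρ.character}

/-- The class in `VRep(W)` of a finite-dimensional complex representation. -/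
def VRep.of {W : Type} [Group W] {V : Type} [AddCommGroup V] [Module ℂ V]
    [FiniteDimensional ℂ V] (ρ : Representation ℂ W V) : VRep W :=
  ⟨ρ.character, Subring.subset_closure ⟨V, _, _, inferInstance, ρ, rfl⟩⟩

/-! ## Equivariant matroids and their Orlik-Solomon algebras -/

/-- A matroid on the ground set `α` that is preserved by the action of the group `W` on `α`. -/
structure EquivariantMatroid (W α : Type) [Group W] [MulAction W α] where
  /-- the underlying matroid -/
  M : Matroid α
  ground_eq : M.E = Set.univ
  indep_smul : ∀ (w : W) (S : Set α), M.Indep S → M.Indep ((fun i => w • i) '' S)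

section OrlikSolomon

variable {α : Type}

/-- The exterior algebra over `ℂ` on generators `e i` indexed by `α`. -/
abbrev Ext (α : Type) : Type := ExteriorAlgebra ℂ (α →₀ ℂ)

/-- The generator `e i`. -/
def e (i : α) : Ext α := ExteriorAlgebra.ι ℂ (Finsupp.single i 1)

/-- The derivation `∂` of the exterior algebra: contraction with the linear form that sends each
generator to `1`. So `∂ (e i₁ ⋯ e iₖ)` is the alternating sum of the products omitting one factor,
`∂ (e i * x) = x - e i * ∂ x` and `∂ 1 = 0`. -/
def partialDer : Ext α →ₗ[ℂ] Ext α :=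
  CliffordAlgebra.contractLeft (Q := (0 : QuadraticForm ℂ (α →₀ ℂ)))
    (Finsupp.linearCombination ℂ (fun _ : α => (1 : ℂ)))

/-- The Orlik-Solomon ideal: the two-sided ideal generated by all `∂ (e i₁ ⋯ e iₖ)` where
`i₁, …, iₖ` enumerates a circuit without repetition. -/
def osIdeal (M : Matroid α) : TwoSidedIdeal (Ext α) :=
  TwoSidedIdeal.span {x | ∃ l : List α, l.Nodup ∧ M.IsCircuit {i | i ∈ l} ∧
    x = partialDer (l.map e).prod}

/-- The Orlik-Solomon algebra of `M`, with complex coefficients. -/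
abbrev OS (M : Matroid α) : Type := Ext α ⧸ (osIdeal M).asIdeal

/-- The degree `p` part of the Orlik-Solomon algebra: the image of the `p`-th exterior power. -/
def osDeg (M : Matroid α) (p : ℕ) : Submodule ℂ (OS M) :=
  (⋀[ℂ]^p (α →₀ ℂ)).map (Ideal.Quotient.mkₐ ℂ (osIdeal M).asIdeal).toLinearMap

instance (M : Matroid α) (p : ℕ) [Finite α] : FiniteDimensional ℂ (osDeg M p) := by
  unfold osDeg; infer_instance

variable {W : Type} [Group W] [MulAction W α]

/-- The action of `w` on the exterior algebra: the algebra automorphism with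
`e i ↦ e (w • i)`. -/
def extAct (w : W) : Ext α →ₐ[ℂ] Ext α :=
  ExteriorAlgebra.map (Finsupp.lmapDomain ℂ ℂ (fun i : α => w • i))

lemma extAct_e (w : W) (i : α) : extAct w (e i) = e (w • i) := by
  simp [extAct, e, Finsupp.mapDomain_single]

lemma extAct_partialDer (w : W) (x : Ext α) :
    extAct w (partialDer x) = partialDer (extAct w x) := by
  induction x using CliffordAlgebra.left_induction with
  | algebraMap r =>
    rw [AlgHom.commutes]
    simp [partialDer]
  | add x y hx hy => simp only [map_add, hx, hy]
  | ι_mul x m hx =>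
    have h1 : extAct w (CliffordAlgebra.ι 0 m) =
        CliffordAlgebra.ι (0 : QuadraticForm ℂ (α →₀ ℂ))
          (Finsupp.lmapDomain ℂ ℂ (fun i : α => w • i) m) :=
      ExteriorAlgebra.map_apply_ι _ _
    have h2 : Finsupp.linearCombination ℂ (fun _ : α => (1 : ℂ))
          (Finsupp.lmapDomain ℂ ℂ (fun i : α => w • i) m) =
        Finsupp.linearCombination ℂ (fun _ : α => (1 : ℂ)) m := by
      simp [Finsupp.lmapDomain_apply, Finsupp.linearCombination_mapDomain, Function.comp_def]
    rw [map_mul (extAct w), h1]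
    unfold partialDer at hx ⊢
    rw [CliffordAlgebra.contractLeft_ι_mul, CliffordAlgebra.contractLeft_ι_mul, map_sub,
      map_smul, map_mul (extAct w), h1, hx, h2]

lemma extAct_one : extAct (α := α) (1 : W) = AlgHom.id ℂ _ := by
  unfold extAct
  simp only [one_smul]
  have : Finsupp.lmapDomain ℂ ℂ (fun i : α => i) = LinearMap.id := Finsupp.lmapDomain_id ℂ ℂ
  rw [this, ExteriorAlgebra.map_id]

lemma extAct_mul (v w : W) :
    extAct (α := α) (v * w) = (extAct v).comp (extAct w) := by
  unfold extAct
  rw [ExteriorAlgebra.map_comp_map, ← Finsupp.lmapDomain_comp]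
  simp only [Function.comp_def, mul_smul]

lemma EquivariantMatroid.isCircuit_smul (N : EquivariantMatroid W α) (w : W) {C : Set α}
    (hC : N.M.IsCircuit C) : N.M.IsCircuit ((fun i => w • i) '' C) := by
  have hg : ∀ S : Set α, S ⊆ N.M.E := fun S => by rw [N.ground_eq]; exact Set.subset_univ S
  have inv : ∀ (v : W) (S : Set α), (fun i => v⁻¹ • i) '' ((fun i => v • i) '' S) = S := by
    intro v S; simp [Set.image_image]
  have inv' : ∀ (v : W) (S : Set α), (fun i => v • i) '' ((fun i => v⁻¹ • i) '' S) = S := by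
    intro v S; simp [Set.image_image]
  rw [Matroid.isCircuit_iff_forall_ssubset] at hC ⊢
  refine ⟨⟨fun h => hC.1.not_indep ?_, hg _⟩, fun I hI => ?_⟩
  · simpa only [inv] using N.indep_smul w⁻¹ _ h
  · have h3 : (fun i => w⁻¹ • i) '' I ⊂ C := by
      have := (MulAction.injective w⁻¹).image_strictMono hI
      rwa [inv] at this
    simpa only [inv'] using N.indep_smul w _ (hC.2 h3)

lemma EquivariantMatroid.extAct_mem (N : EquivariantMatroid W α) (w : W) (x : Ext α)
    (hx : x ∈ osIdeal N.M) : extAct w x ∈ osIdeal N.M := by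
  have : osIdeal N.M ≤ (osIdeal N.M).comap (extAct w) := by
    refine TwoSidedIdeal.span_le.2 ?_
    rintro _ ⟨l, hl, hc, rfl⟩
    rw [SetLike.mem_coe, TwoSidedIdeal.mem_comap, extAct_partialDer, map_list_prod, List.map_map]
    refine TwoSidedIdeal.subset_span ⟨l.map (fun i => w • i),
      hl.map (MulAction.injective w), ?_, ?_⟩
    · convert N.isCircuit_smul w hc using 1
      ext i; simp
    · rw [List.map_map]
      congr 3
      funext i
      exact extAct_e w i
  exact (TwoSidedIdeal.mem_comap _).1 (this hx)

/-- The action of `w` on the Orlik-Solomon algebra. -/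
def EquivariantMatroid.osAct (N : EquivariantMatroid W α) (w : W) : OS N.M →ₐ[ℂ] OS N.M :=
  Ideal.Quotient.liftₐ _ ((Ideal.Quotient.mkₐ ℂ (osIdeal N.M).asIdeal).comp (extAct w))
    (fun x hx => (Ideal.Quotient.eq_zero_iff_mem).2
      (TwoSidedIdeal.mem_asIdeal.2 (N.extAct_mem w x (TwoSidedIdeal.mem_asIdeal.1 hx))))

lemma EquivariantMatroid.osAct_mk (N : EquivariantMatroid W α) (w : W) (x : Ext α) :
    N.osAct w (Ideal.Quotient.mkₐ ℂ _ x) = Ideal.Quotient.mkₐ ℂ _ (extAct w x) := rfl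

lemma EquivariantMatroid.osAct_mem (N : EquivariantMatroid W α) (w : W) (p : ℕ) (x : OS N.M)
    (hx : x ∈ osDeg N.M p) : N.osAct w x ∈ osDeg N.M p := by
  obtain ⟨y, hy, rfl⟩ := hx
  refine ⟨extAct w y, ?_, rfl⟩
  have h1 : (LinearMap.range (ExteriorAlgebra.ι ℂ (M := α →₀ ℂ)) ^ p).map
      (extAct w).toLinearMap ≤ LinearMap.range (ExteriorAlgebra.ι ℂ (M := α →₀ ℂ)) ^ p := by
    rw [Submodule.map_pow]
    refine pow_le_pow_left' ?_ p
    rintro _ ⟨_, ⟨m, rfl⟩, rfl⟩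
    exact ⟨_, (ExteriorAlgebra.map_apply_ι _ _).symm⟩
  exact h1 ⟨y, hy, rfl⟩

/-- The representation of `W` on the degree `p` part of the Orlik-Solomon algebra. -/
def EquivariantMatroid.osRep (N : EquivariantMatroid W α) (p : ℕ) :
    Representation ℂ W (osDeg N.M p) where
  toFun w := (N.osAct w).toLinearMap.restrict (N.osAct_mem w p)
  map_one' := by
    ext ⟨x, hx⟩
    obtain ⟨y, -, rfl⟩ := hx
    change N.osAct 1 (Ideal.Quotient.mkₐ ℂ _ y) = Ideal.Quotient.mkₐ ℂ _ y
    rw [N.osAct_mk, extAct_one, AlgHom.id_apply]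
  map_mul' v w := by
    ext ⟨x, hx⟩
    obtain ⟨y, -, rfl⟩ := hx
    change N.osAct (v * w) (Ideal.Quotient.mkₐ ℂ _ y) =
      N.osAct v (N.osAct w (Ideal.Quotient.mkₐ ℂ _ y))
    rw [N.osAct_mk, N.osAct_mk, N.osAct_mk, extAct_mul, AlgHom.comp_apply]

/-- The equivariant characteristic polynomial
`H_M^W(t) = ∑_{p=0}^{rk M} (-1)^p t^{rk M - p} OS_{M,p}^W`, a polynomial over `VRep(W)`. -/
def EquivariantMatroid.charPoly [Finite α] (N : EquivariantMatroid W α) : (VRep W)[X] :=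
  ∑ p ∈ Finset.range (N.M.eRank.toNat + 1),
    Polynomial.monomial (N.M.eRank.toNat - p) ((-1) ^ p * VRep.of (N.osRep p))

end OrlikSolomon

/-! ## Uniform matroids -/

/-- The uniform matroid of rank `min d n` on `n` elements: a set is independent if and only if it
has at most `d` elements. -/
def uniformMatroid (n d : ℕ) : Matroid (Fin n) :=
  (IndepMatroid.ofFinite (E := Set.univ) Set.finite_univ (fun I => I.ncard ≤ d)
    (by simp)
    (fun I J hJ hIJ => (Set.ncard_le_ncard hIJ (Set.toFinite J)).trans hJ)
    (fun I J hI hJ hIJ => by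
      obtain ⟨x, hxJ, hxI⟩ := Set.exists_mem_notMem_of_ncard_lt_ncard hIJ (Set.toFinite I)
      refine ⟨x, hxJ, hxI, ?_⟩
      rw [Set.ncard_insert_of_notMem hxI (Set.toFinite I)]
      omega)
    (fun I _ => Set.subset_univ I)).matroid

/-- The uniform matroid `U_{m,d}` of rank `d` on `m + d` elements, with the action of the symmetric
group `S_{m+d}`. -/
def uniform (m d : ℕ) : EquivariantMatroid (Equiv.Perm (Fin (m + d))) (Fin (m + d)) where
  M := uniformMatroid (m + d) d
  ground_eq := rfl
  indep_smul w S hS := by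
    change ((fun i => w • i) '' S).ncard ≤ d
    rw [Set.ncard_image_of_injective _ (MulAction.injective w)]
    exact hS

/-! ## Symmetric functions and the Frobenius characteristic -/

/-- The ring `Λ` of symmetric functions (with complex coefficients): the formal power series in
the variables `x₀, x₁, x₂, …` that are invariant under all permutations of the variables and have
bounded degree. -/
def Sym : Subalgebra ℂ (MvPowerSeries ℕ ℂ) where
  carrier := {f | (∀ σ : Equiv.Perm ℕ, MvPowerSeries.renameEquiv ℂ σ f = f) ∧
    ∃ N : ℕ, ∀ a : ℕ →₀ ℕ, N < a.degree → MvPowerSeries.coeff a f = 0}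
  mul_mem' := by
    rintro f g ⟨hf, N, hN⟩ ⟨hg, K, hK⟩
    refine ⟨fun σ => by rw [map_mul, hf, hg], N + K, fun a ha => ?_⟩
    classical
    rw [MvPowerSeries.coeff_mul]
    refine Finset.sum_eq_zero fun b hb => ?_
    rw [Finset.HasAntidiagonal.mem_antidiagonal] at hb
    rw [← hb, map_add] at ha
    by_cases h : N < b.1.degree
    · rw [hN _ h, zero_mul]
    · rw [hK _ (by omega), mul_zero]
  add_mem' := by
    rintro f g ⟨hf, N, hN⟩ ⟨hg, K, hK⟩
    refine ⟨fun σ => by rw [map_add, hf, hg], max N K, fun a ha => ?_⟩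
    rw [map_add, hN a (by omega), hK a (by omega), add_zero]
  algebraMap_mem' r := by
    refine ⟨fun σ => AlgEquiv.commutes _ r, 0, fun a ha => ?_⟩
    classical
    rw [MvPowerSeries.algebraMap_apply, MvPowerSeries.coeff_C, if_neg]
    rintro rfl
    simp at ha

/-- The power sum `p_k = ∑ᵢ xᵢᵏ` (for `k ≥ 1`). -/
def powerSum (k : ℕ) : Sym :=
  ⟨fun a => open Classical in if ∃ i, a = Finsupp.single i k then 1 else 0, by
    classical
    refine ⟨fun σ => ?_, k, fun a ha => ?_⟩
    · ext a
      obtain ⟨b, rfl⟩ : ∃ b, a = Finsupp.embDomain σ.toEmbedding b :=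
        ⟨Finsupp.embDomain σ.symm.toEmbedding a, by
          ext i
          obtain ⟨j, rfl⟩ := σ.surjective i
          rw [show σ j = σ.toEmbedding j from rfl, Finsupp.embDomain_apply_self]
          conv_rhs => rw [show j = σ.symm.toEmbedding (σ j) by simp]
          rw [Finsupp.embDomain_apply_self]
          rfl⟩
      have h := MvPowerSeries.coeff_embDomain_rename (R := ℂ) σ.toEmbedding
        (fun a => if ∃ i, a = Finsupp.single i k then 1 else 0) b
      refine h.trans ?_
      change (if ∃ i, b = Finsupp.single i k then (1 : ℂ) else 0) =
        if ∃ i, Finsupp.embDomain σ.toEmbedding b = Finsupp.single i k then 1 else 0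
      congr 1
      rw [eq_iff_iff]
      constructor
      · rintro ⟨i, rfl⟩
        exact ⟨σ i, Finsupp.embDomain_single _ _ _⟩
      · rintro ⟨i, hi⟩
        refine ⟨σ.symm i, Finsupp.embDomain_injective σ.toEmbedding ?_⟩
        rw [hi, Finsupp.embDomain_single]
        simp
    · change (if ∃ i, a = Finsupp.single i k then (1 : ℂ) else 0) = 0
      rw [if_neg]
      rintro ⟨i, rfl⟩
      simp at ha⟩

/-- The Frobenius characteristic
`ch(V) = (1/n!) ∑_{w ∈ S_n} χ_V(w) p_{ρ(w)}`, where `ρ(w)` is the cycle type of `w` (including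
fixed points) and `p_ρ` is the product of the power sums `p_k` over the parts `k` of `ρ`. -/
def frob (n : ℕ) (v : VRep (Equiv.Perm (Fin n))) : Sym :=
  (1 / (n.factorial : ℂ)) •
    ∑ w : Equiv.Perm (Fin n), (v : Equiv.Perm (Fin n) → ℂ) w •
      (w.partition.parts.map powerSum).prod

/-- The Frobenius characteristic of graded virtual representations, coefficient by coefficient. -/
def grFrob (n : ℕ) (P : (VRep (Equiv.Perm (Fin n)))[X]) : Sym[X] :=
  P.sum fun i v => Polynomial.monomial i (frob n v)

/-- `s[n] = ch V[n]`, the Schur function of the one-row partition of `n`; here `V[n]` is the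
trivial representation of `S_n`. -/
def schurRow (n : ℕ) : Sym :=
  frob n (VRep.of (Representation.trivial ℂ (Equiv.Perm (Fin n)) ℂ))

/-! ## Generating functions -/

/-- The ring `Λ[[t,u,x]]`, with `t`, `u`, `x` the variables number `0`, `1`, `2`. -/
abbrev GenRing : Type := MvPowerSeries (Fin 3) Sym

/-- The variable `t`. -/
def tVar : GenRing := MvPowerSeries.X 0
/-- The variable `u`. -/
def uVar : GenRing := MvPowerSeries.X 1
/-- The variable `x`. -/
def xVar : GenRing := MvPowerSeries.X 2

/-- The power series `s(y) = ∑_{n ≥ 0} s[n] yⁿ`. -/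
def sSeries : PowerSeries Sym := PowerSeries.mk schurRow

/-- `s(a)` for a power series `a` in `t`, `u`, `x` without constant term. -/
def s (a : GenRing) : GenRing := sSeries.subst a

/-- The generating function `𝓗(t,u,x) = ∑_{d ≥ 1} ∑_{m ≥ 0} ch H_{m,d}(t) u^d x^m`, where `H_{m,d}`
is the equivariant characteristic polynomial of `U_{m,d}`: the coefficient of `t^i u^d x^m` is the
coefficient of `t^i` in `ch H_{m,d}(t)` for `d ≥ 1`, and `0` for `d = 0`. -/
def genH : GenRing := fun a =>
  if 1 ≤ a 1 then (grFrob (a 2 + a 1) (uniform (a 2) (a 1)).charPoly).coeff (a 0) else 0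

/-- `𝓗(t,u,0)`. -/
def genHZero : GenRing := MvPowerSeries.subst ![tVar, uVar, 0] genH

/-- The field of fractions of `Λ[[t,u,x]]`. -/
abbrev FracRing : Type := FractionRing GenRing

/-- The embedding of `Λ[[t,u,x]]` in its field of fractions. -/
abbrev toFrac : GenRing →+* FracRing := algebraMap GenRing FracRing

end EqKL

end

open scoped Polynomial

noncomputable section

namespace EqKL

open Equiv

/-! ## Power sums of permutations and the Frobenius characteristic of class functions -/

/-! Write `n = m + d` and let `Λ^p` be the exterior powers of the permutation representation of
`S_n`. The circuits of `U_{m,d}` are the `(d+1)`-subsets, so the Orlik-Solomon ideal vanishes below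
degree `d` and equals `∂ Λ^{d+1}` in degree `d`. Hence `OS_p = Λ^p` for `p < d`. The complex `(Λ,
∂)` is exact for `n ≥ 1`, so `OS_d = Λ^d / ker ∂ ≅ ∂ Λ^d`, whose character is an alternating sum of
those of `Λ^j` with `j < d` (`character_osRep_uniform_of_lt`, `character_osRep_uniform_top`).

The character of `Λ^p` is a sum of principal minors of permutation matrices, which gives `ch Λ^p =
e_p s[n-p]` (`frobFun_trace_extPowerAct`). Therefore `ch H_{m,d} = ∑_{p<d} (-1)^p e_p s[m+d-p]
(t^{d-p} - 1)`.

Summing over `m` and `d`, the factor `∑ (-1)^p e_p u^p` splits off. It is `1/s(u)`, because the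
Euler characteristic of the exact complex vanishes (`elemSeries_mul_sSeries`). The other factor is a
difference of two series of the form `∑ s[k+m] y^k x^m = (y s(y) - x s(x)) / (y - x)`, with `y = tu`
and `y = u` (`sub_mul_schurTU`, `sub_mul_schurU`). The second formula is the case `x = 0`. -/

lemma parts_partition_subtypeCongr {α : Type*} [Fintype α] [DecidableEq α] {p : α → Prop}
    [DecidablePred p] (σ : Perm {a // p a}) (τ : Perm {a // ¬ p a}) :
    (σ.subtypeCongr τ).partition.parts = σ.partition.parts + τ.partition.parts := by
  have hmul : σ.subtypeCongr τ = Perm.ofSubtype σ * Perm.ofSubtype τ := by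
    ext a
    by_cases h : p a
    · rw [Perm.subtypeCongr.left_apply _ _ h, Perm.mul_apply,
        Perm.ofSubtype_apply_of_not_mem τ (not_not.2 h), Perm.ofSubtype_apply_of_mem σ h]
    · rw [Perm.subtypeCongr.right_apply _ _ h, Perm.mul_apply,
        Perm.ofSubtype_apply_of_mem τ h, Perm.ofSubtype_apply_of_not_mem σ (τ ⟨a, h⟩).2]
  have hdisj : Perm.Disjoint (Perm.ofSubtype σ) (Perm.ofSubtype τ) := by
    intro a
    by_cases h : p a
    · exact Or.inr (Perm.ofSubtype_apply_of_not_mem τ (not_not.2 h))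
    · exact Or.inl (Perm.ofSubtype_apply_of_not_mem σ h)
  have hct : (σ.subtypeCongr τ).cycleType = σ.cycleType + τ.cycleType := by
    rw [hmul, hdisj.cycleType_mul, Perm.cycleType_ofSubtype, Perm.cycleType_ofSubtype]
  have hcard := congrArg Multiset.sum hct
  rw [Multiset.sum_add, Perm.sum_cycleType, Perm.sum_cycleType, Perm.sum_cycleType] at hcard
  -- `partition` pads the cycle type with a part `1` for each fixed point, so the numbers of fixed
  -- points must be seen to add up as well.
  rw [Perm.parts_partition, Perm.parts_partition, Perm.parts_partition, hct, hcard]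
  have h1 := Finset.card_le_univ σ.support
  have h2 := Finset.card_le_univ τ.support
  have h3 := Fintype.card_subtype_compl p
  have h4 := Fintype.card_subtype_le p
  have h5 : Fintype.card α - (σ.support.card + τ.support.card) =
      (Fintype.card {a // p a} - σ.support.card) +
        (Fintype.card {a // ¬ p a} - τ.support.card) := by omega
  rw [h5, Multiset.replicate_add]
  abel

lemma parts_partition_permCongr {α β : Type*} [Fintype α] [DecidableEq α] [Fintype β]
    [DecidableEq β] (f : α ≃ β) (σ : Perm α) :
    (f.permCongr σ).partition.parts = σ.partition.parts := by
  have h : f.permCongr σ = σ.extendDomain (f.trans (Equiv.Set.univ β).symm) := by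
    ext b
    rw [Perm.extendDomain_apply_subtype (p := fun b => b ∈ Set.univ) _ _ (Set.mem_univ b)]
    simp
  have hct : (f.permCongr σ).cycleType = σ.cycleType := by
    rw [h, Perm.cycleType_extendDomain]
  have hcard := congrArg Multiset.sum hct
  rw [Perm.sum_cycleType, Perm.sum_cycleType] at hcard
  rw [Perm.parts_partition, Perm.parts_partition, hct, hcard, Fintype.card_congr f]

/-- The product `p_{ρ(w)}` of power sums over the cycles (including the fixed points) of `w`. -/
def cyclePowerSum {α : Type*} [Fintype α] [DecidableEq α] (w : Perm α) : Sym :=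
  (w.partition.parts.map powerSum).prod

lemma cyclePowerSum_subtypeCongr {α : Type*} [Fintype α] [DecidableEq α] {p : α → Prop}
    [DecidablePred p] (σ : Perm {a // p a}) (τ : Perm {a // ¬ p a}) :
    cyclePowerSum (σ.subtypeCongr τ) = cyclePowerSum σ * cyclePowerSum τ := by
  rw [cyclePowerSum, parts_partition_subtypeCongr, Multiset.map_add, Multiset.prod_add]
  rfl

lemma cyclePowerSum_permCongr {α β : Type*} [Fintype α] [DecidableEq α] [Fintype β]
    [DecidableEq β] (f : α ≃ β) (σ : Perm α) :
    cyclePowerSum (f.permCongr σ) = cyclePowerSum σ := by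
  rw [cyclePowerSum, parts_partition_permCongr]
  rfl

/-- The Frobenius characteristic of a function on the symmetric group. -/
def frobFun (n : ℕ) : (Perm (Fin n) → ℂ) →ₗ[ℂ] Sym where
  toFun χ := (1 / (n.factorial : ℂ)) • ∑ w : Perm (Fin n), χ w • cyclePowerSum w
  map_add' χ ψ := by simp only [Pi.add_apply, add_smul, Finset.sum_add_distrib, smul_add]
  map_smul' c χ := by
    simp only [Pi.smul_apply, smul_eq_mul, mul_smul, ← Finset.smul_sum, RingHom.id_apply]
    rw [smul_comm]

lemma frobFun_apply (n : ℕ) (χ : Perm (Fin n) → ℂ) :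
    frobFun n χ = (1 / (n.factorial : ℂ)) • ∑ w : Perm (Fin n), χ w • cyclePowerSum w := rfl

lemma frob_eq_frobFun (n : ℕ) (v : VRep (Perm (Fin n))) : frob n v = frobFun n v := rfl

lemma schurRow_eq (n : ℕ) : schurRow n = frobFun n fun _ => 1 := by
  rw [schurRow, frob_eq_frobFun]
  congr 1
  ext w
  simp [VRep.of, Representation.character]

/-- The elementary symmetric function, as the Frobenius characteristic of the sign character. -/
def elemSym (n : ℕ) : Sym := frobFun n fun w => ((Perm.sign w : ℤ) : ℂ)

lemma sum_cyclePowerSum {α : Type*} [Fintype α] [DecidableEq α] {k : ℕ}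
    (h : Fintype.card α = k) :
    ∑ w : Perm α, cyclePowerSum w = (k.factorial : ℂ) • schurRow k := by
  rw [schurRow_eq, frobFun_apply, smul_smul, mul_one_div_cancel (by exact_mod_cast k.factorial_ne_zero),
    one_smul]
  refine Fintype.sum_equiv (Fintype.equivFinOfCardEq h).permCongr _ _ fun w => ?_
  rw [cyclePowerSum_permCongr, one_smul]

lemma sum_sign_smul_cyclePowerSum {α : Type*} [Fintype α] [DecidableEq α] {k : ℕ}
    (h : Fintype.card α = k) :
    ∑ w : Perm α, ((Perm.sign w : ℤ) : ℂ) • cyclePowerSum w = (k.factorial : ℂ) • elemSym k := by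
  rw [elemSym, frobFun_apply, smul_smul, mul_one_div_cancel (by exact_mod_cast k.factorial_ne_zero),
    one_smul]
  refine Fintype.sum_equiv (Fintype.equivFinOfCardEq h).permCongr _ _ fun w => ?_
  rw [cyclePowerSum_permCongr, Perm.sign_permCongr]

/-- The principal minor on `S` of the permutation matrix of `w`. -/
def permMinor {α : Type*} [DecidableEq α] (S : Finset α) (w : Perm α) : ℂ :=
  (Matrix.of fun i j : S => if w j = i then (1 : ℂ) else 0).det

/-- In the Leibniz expansion a product of 0/1 entries survives only when `σ` agrees with `w` on `S`.
-/
lemma permMinor_eq_sum {α : Type*} [DecidableEq α] (S : Finset α) (w : Perm α) :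
    permMinor S w = ∑ σ : Perm {a // a ∈ S},
      if ∀ i : S, w i = σ i then ((Perm.sign σ : ℤ) : ℂ) else 0 := by
  rw [permMinor, Matrix.det_apply]
  refine Finset.sum_congr rfl fun σ _ => ?_
  simp only [Matrix.of_apply, Finset.prod_ite_zero, Finset.mem_univ, forall_true_left,
    Finset.prod_const_one]
  split_ifs <;> simp [Units.smul_def]

/-- The minor is nonzero only if `w` preserves `S`. Such `w` are the pairs of a permutation `σ` of
`S`, contributing its sign, and a permutation `τ` of the complement, so the sum factors. -/
lemma sum_permMinor {α : Type*} [Fintype α] [DecidableEq α] (S : Finset α) {p q : ℕ}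
    (hp : S.card = p) (hq : Fintype.card α = p + q) :
    ∑ w : Perm α, permMinor S w • cyclePowerSum w =
      ((p.factorial : ℂ) • elemSym p) * ((q.factorial : ℂ) • schurRow q) := by
  have hpc : Fintype.card {a // a ∈ S} = p := by simpa using hp
  have hqc : Fintype.card {a // ¬ a ∈ S} = q := by
    rw [Fintype.card_subtype_compl, hpc, hq]; omega
  rw [← sum_sign_smul_cyclePowerSum hpc, ← sum_cyclePowerSum hqc, Finset.sum_mul_sum]
  simp only [permMinor_eq_sum, Finset.sum_smul]
  rw [Finset.sum_comm]
  refine Finset.sum_congr rfl fun σ _ => ?_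
  refine (Finset.sum_of_injOn (fun τ => σ.subtypeCongr τ) ?_ ?_ ?_ ?_).symm
  · intro τ _ τ' _ h
    ext a
    have := congrArg (fun w : Perm α => w a) h
    simpa [Perm.subtypeCongr.right_apply_subtype] using this
  · intro τ _; simp
  -- A `w` agreeing with `σ` on `S` preserves `S`, hence comes from some `τ`; every other `w`
  -- contributes `0`.
  · intro w _ hw
    rw [if_neg, zero_smul]
    intro h
    refine hw ?_
    have hS : ∀ a, a ∈ S ↔ w a ∈ S := by
      intro a
      constructor
      · intro ha
        have := h ⟨a, ha⟩
        rw [show w a = _ from this]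
        exact (σ ⟨a, ha⟩).2
      · intro ha
        have h1 := h (σ.symm ⟨w a, ha⟩)
        rw [Equiv.apply_symm_apply] at h1
        have h2 := w.injective h1
        rw [← h2]
        exact (σ.symm ⟨w a, ha⟩).2
    refine ⟨w.subtypePerm fun a => not_congr (hS a).symm, by simp, ?_⟩
    ext a
    by_cases ha : a ∈ S
    · simp only [Perm.subtypeCongr.left_apply _ _ ha]
      exact (h ⟨a, ha⟩).symm
    · simp only [Perm.subtypeCongr.right_apply _ _ ha]
      rfl
  · intro τ _
    rw [if_pos fun i => Perm.subtypeCongr.left_apply_subtype σ τ i, cyclePowerSum_subtypeCongr,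
      smul_mul_assoc]
    congr!

lemma frobFun_sum_permMinor (n p : ℕ) (hp : p ≤ n) :
    frobFun n (fun w => ∑ S ∈ Finset.univ.powersetCard p, permMinor S w) =
      elemSym p * schurRow (n - p) := by
  rw [frobFun_apply]
  simp only [Finset.sum_smul]
  rw [Finset.sum_comm, Finset.sum_congr rfl fun S hS =>
    sum_permMinor S (Finset.mem_powersetCard.1 hS).2 (by rw [Fintype.card_fin]; omega : _ = p + (n - p)),
    Finset.sum_const, Finset.card_powersetCard, Finset.card_univ, Fintype.card_fin,
    smul_mul_smul_comm, ← Nat.cast_smul_eq_nsmul ℂ, smul_smul, smul_smul]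
  convert one_smul ℂ _
  rw [← Nat.choose_mul_factorial_mul_factorial hp]
  have h1 : (p.factorial : ℂ) ≠ 0 := by exact_mod_cast p.factorial_ne_zero
  have h2 : ((n - p).factorial : ℂ) ≠ 0 := by exact_mod_cast (n - p).factorial_ne_zero
  have h3 : (n.choose p : ℂ) ≠ 0 := by exact_mod_cast (Nat.choose_pos hp).ne'
  push_cast
  field_simp

/-! ## The exterior powers of a permutation representation -/

/-- Computes a trace on a quotient upstairs. For a linear section `τ` of `π`, the map `Q ∘ τ` is
again a section and `Q = (Q ∘ τ) ∘ π`, so the claim is the cyclicity of the trace. No equivariance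
of `Q` is needed. -/
lemma trace_eq_trace_comp_of_surjective {E F : Type*} [AddCommGroup E] [Module ℂ E]
    [FiniteDimensional ℂ E] [AddCommGroup F] [Module ℂ F] [FiniteDimensional ℂ F]
    {π : E →ₗ[ℂ] F} (hπ : Function.Surjective π) {f : E →ₗ[ℂ] E} {g : F →ₗ[ℂ] F}
    (hfg : π ∘ₗ f = g ∘ₗ π) (Q : E →ₗ[ℂ] E) (hQ : π ∘ₗ Q = π)
    (hker : ∀ x, π x = 0 → Q x = 0) :
    LinearMap.trace ℂ F g = LinearMap.trace ℂ E (f ∘ₗ Q) := by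
  obtain ⟨τ, hτ⟩ := π.exists_rightInverse_of_surjective (LinearMap.range_eq_top.2 hπ)
  have h1 : (Q ∘ₗ τ) ∘ₗ π = Q := by
    ext x
    have h := hker (τ (π x) - x) (by
      rw [map_sub, ← LinearMap.comp_apply π τ, hτ, LinearMap.id_apply, sub_self])
    rw [map_sub, sub_eq_zero] at h
    exact h
  have h2 : π ∘ₗ (Q ∘ₗ τ) = LinearMap.id := by
    rw [← LinearMap.comp_assoc, hQ, hτ]
  calc LinearMap.trace ℂ F g = LinearMap.trace ℂ F (π ∘ₗ (f ∘ₗ (Q ∘ₗ τ))) := by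
        rw [← LinearMap.comp_assoc, hfg, LinearMap.comp_assoc, h2, LinearMap.comp_id]
    _ = LinearMap.trace ℂ E (f ∘ₗ Q) := by
        rw [LinearMap.trace_comp_comm', LinearMap.comp_assoc, h1]

section Exterior

variable {α : Type} {W : Type} [Group W] [MulAction W α]

lemma extAct_mem_exteriorPower (w : W) (p : ℕ) (x : Ext α) (hx : x ∈ ⋀[ℂ]^p (α →₀ ℂ)) :
    extAct w x ∈ ⋀[ℂ]^p (α →₀ ℂ) := by
  have h : (LinearMap.range (ExteriorAlgebra.ι ℂ (M := α →₀ ℂ)) ^ p).map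
      (extAct w).toLinearMap ≤ LinearMap.range (ExteriorAlgebra.ι ℂ (M := α →₀ ℂ)) ^ p := by
    rw [Submodule.map_pow]
    refine pow_le_pow_left' ?_ p
    rintro _ ⟨_, ⟨m, rfl⟩, rfl⟩
    exact ⟨_, (ExteriorAlgebra.map_apply_ι _ _).symm⟩
  exact h ⟨x, hx, rfl⟩

/-- The action of `w` on the `p`-th exterior power of the permutation representation. -/
def extPowerAct (w : W) (p : ℕ) : ⋀[ℂ]^p (α →₀ ℂ) →ₗ[ℂ] ⋀[ℂ]^p (α →₀ ℂ) :=
  (extAct w).toLinearMap.restrict (extAct_mem_exteriorPower w p)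

/-! ### The Koszul complex of `∂` and its contracting homotopy -/

lemma partialDer_ι_mul (v : α →₀ ℂ) (x : Ext α) :
    partialDer (ExteriorAlgebra.ι ℂ v * x) =
      Finsupp.linearCombination ℂ (fun _ : α => (1 : ℂ)) v • x -
        ExteriorAlgebra.ι ℂ v * partialDer x :=
  CliffordAlgebra.contractLeft_ι_mul _ _ _

lemma partialDer_partialDer (x : Ext α) : partialDer (partialDer x) = 0 :=
  CliffordAlgebra.contractLeft_contractLeft _ _

lemma partialDer_of_mem_zero {x : Ext α} (hx : x ∈ ⋀[ℂ]^0 (α →₀ ℂ)) : partialDer x = 0 := by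
  rw [ExteriorAlgebra.exteriorPower, pow_zero] at hx
  obtain ⟨r, rfl⟩ : ∃ r : ℂ, algebraMap ℂ (Ext α) r = x := by
    simpa [Submodule.mem_one] using hx
  simp [partialDer]

lemma ι_mul_mem_exteriorPower (v : α →₀ ℂ) {p : ℕ} {x : Ext α} (hx : x ∈ ⋀[ℂ]^p (α →₀ ℂ)) :
    ExteriorAlgebra.ι ℂ v * x ∈ ⋀[ℂ]^(p + 1) (α →₀ ℂ) := by
  rw [ExteriorAlgebra.exteriorPower, pow_succ']
  exact Submodule.mul_mem_mul ⟨v, rfl⟩ hx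

lemma partialDer_mem_exteriorPower (p : ℕ) : ∀ x ∈ ⋀[ℂ]^(p + 1) (α →₀ ℂ),
    partialDer x ∈ ⋀[ℂ]^p (α →₀ ℂ) := by
  induction p with
  | zero =>
    intro x hx
    rw [ExteriorAlgebra.exteriorPower, zero_add, pow_one] at hx
    obtain ⟨v, rfl⟩ := hx
    have := partialDer_ι_mul v 1
    rw [mul_one, partialDer_of_mem_zero (x := 1), mul_zero, sub_zero] at this
    · rw [this, ExteriorAlgebra.exteriorPower, pow_zero]
      exact Submodule.smul_mem _ _ (Submodule.one_le.1 le_rfl)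
    · rw [ExteriorAlgebra.exteriorPower, pow_zero]
      exact Submodule.one_le.1 le_rfl
  | succ p ih =>
    intro x hx
    rw [ExteriorAlgebra.exteriorPower, pow_succ'] at hx
    refine Submodule.mul_induction_on hx ?_ fun x y hx hy => ?_
    · rintro _ ⟨v, rfl⟩ y hy
      rw [partialDer_ι_mul]
      exact Submodule.sub_mem _ (Submodule.smul_mem _ _ hy)
        (ι_mul_mem_exteriorPower v (ih y hy))
    · rw [map_add]
      exact Submodule.add_mem _ hx hy

/-- The restriction of `∂` to an exterior power. -/
def koszulD (α : Type) (p : ℕ) : ⋀[ℂ]^(p + 1) (α →₀ ℂ) →ₗ[ℂ] ⋀[ℂ]^p (α →₀ ℂ) :=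
  partialDer.restrict (partialDer_mem_exteriorPower p)

lemma coe_koszulD (p : ℕ) (x : ⋀[ℂ]^(p + 1) (α →₀ ℂ)) :
    (koszulD α p x : Ext α) = partialDer (x : Ext α) := rfl

lemma extPowerAct_comp_koszulD (w : W) (p : ℕ) :
    extPowerAct w p ∘ₗ koszulD α p = koszulD α p ∘ₗ extPowerAct w (p + 1) := by
  exact LinearMap.ext fun x => Subtype.ext (extAct_partialDer w (x : Ext α))

section Fintype

variable [Fintype α]

/-- The average of the generators. -/
def averageVec (α : Type) [Fintype α] : α →₀ ℂ :=
  Finsupp.equivFunOnFinite.symm fun _ => (Fintype.card α : ℂ)⁻¹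

lemma linearCombination_averageVec [Nonempty α] :
    Finsupp.linearCombination ℂ (fun _ : α => (1 : ℂ)) (averageVec α) = 1 := by
  rw [Finsupp.linearCombination_apply, Finsupp.sum_fintype _ _ (by simp)]
  simp [averageVec]

/-- Multiplication by the average of the generators. -/
def koszulH (α : Type) [Fintype α] (p : ℕ) :
    ⋀[ℂ]^p (α →₀ ℂ) →ₗ[ℂ] ⋀[ℂ]^(p + 1) (α →₀ ℂ) :=
  (LinearMap.mulLeft ℂ (ExteriorAlgebra.ι ℂ (averageVec α))).restrict
    fun _ hx => ι_mul_mem_exteriorPower _ hx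

lemma coe_koszulH (p : ℕ) (x : ⋀[ℂ]^p (α →₀ ℂ)) :
    (koszulH α p x : Ext α) = ExteriorAlgebra.ι ℂ (averageVec α) * (x : Ext α) := rfl

/-- The trace of `w` on the boundaries in the `p`-th exterior power. -/
def boundaryTrace (α : Type) [Fintype α] [MulAction W α] (w : W) (p : ℕ) : ℂ :=
  LinearMap.trace ℂ _ (extPowerAct w p ∘ₗ koszulD α p ∘ₗ koszulH α p)

/-- On a nonempty set, `koszulH ∘ koszulD` projects onto a complement of the cycles, which `∂`
identifies with the boundaries one degree lower. On traces this is cyclicity together with the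
equivariance of `∂`. -/
lemma trace_extPowerAct_comp_koszulH_comp_koszulD (w : W) (p : ℕ) :
    LinearMap.trace ℂ _ (extPowerAct (α := α) w (p + 1) ∘ₗ koszulH α p ∘ₗ koszulD α p) =
      boundaryTrace α w p := by
  rw [← LinearMap.comp_assoc, LinearMap.trace_comp_comm', ← LinearMap.comp_assoc,
    ← extPowerAct_comp_koszulD, LinearMap.comp_assoc, boundaryTrace]

variable [Nonempty α]

lemma koszulD_comp_koszulH_zero : koszulD α 0 ∘ₗ koszulH α 0 = LinearMap.id := by
  refine LinearMap.ext fun x => Subtype.ext ?_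
  simp only [LinearMap.comp_apply, coe_koszulD, coe_koszulH, partialDer_ι_mul,
    linearCombination_averageVec, one_smul, partialDer_of_mem_zero x.2, mul_zero, sub_zero,
    LinearMap.id_apply]

/-- The linear form defining `∂` takes the value `1` on the average vector, so the Leibniz rule
makes multiplication by that vector a contracting homotopy. An empty set has no such vector. -/
lemma koszul_homotopy (p : ℕ) :
    koszulD α (p + 1) ∘ₗ koszulH α (p + 1) + koszulH α p ∘ₗ koszulD α p = LinearMap.id := by
  refine LinearMap.ext fun x => Subtype.ext ?_
  simp only [LinearMap.add_apply, LinearMap.comp_apply, Submodule.coe_add, coe_koszulD,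
    coe_koszulH, partialDer_ι_mul, linearCombination_averageVec, one_smul, sub_add_cancel,
    LinearMap.id_apply]

lemma trace_extPowerAct_zero (w : W) :
    LinearMap.trace ℂ _ (extPowerAct (α := α) w 0) = boundaryTrace α w 0 := by
  rw [boundaryTrace, koszulD_comp_koszulH_zero, LinearMap.comp_id]

lemma trace_extPowerAct_succ (w : W) (p : ℕ) :
    LinearMap.trace ℂ _ (extPowerAct (α := α) w (p + 1)) =
      boundaryTrace α w (p + 1) + boundaryTrace α w p := by
  rw [← trace_extPowerAct_comp_koszulH_comp_koszulD w p, boundaryTrace, ← map_add,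
    ← LinearMap.comp_add, koszul_homotopy, LinearMap.comp_id]

/-- Each exterior power is boundaries plus a copy of the boundaries one degree lower, so the
alternating sum telescopes. -/
lemma sum_trace_extPowerAct (w : W) (p : ℕ) :
    ∑ j ∈ Finset.range (p + 1), (-1) ^ j * LinearMap.trace ℂ _ (extPowerAct (α := α) w j) =
      (-1) ^ p * boundaryTrace α w p := by
  induction p with
  | zero => simp [trace_extPowerAct_zero]
  | succ p ih =>
    rw [Finset.sum_range_succ, ih, trace_extPowerAct_succ]
    ring

lemma sum_trace_extPowerAct_card (w : W) :
    ∑ j ∈ Finset.range (Fintype.card α + 1),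
      (-1) ^ j * LinearMap.trace ℂ _ (extPowerAct (α := α) w j) = 0 := by
  have h0 : Module.finrank ℂ (⋀[ℂ]^(Fintype.card α + 1) (α →₀ ℂ)) = 0 := by
    rw [exteriorPower.finrank_eq]
    simp
  -- The target exterior power lies above the top degree, so no boundaries remain.
  have h1 : koszulH α (Fintype.card α) = 0 := by
    have := Module.finrank_zero_iff.1 h0
    exact LinearMap.ext fun x => Subsingleton.elim _ _
  rw [sum_trace_extPowerAct, boundaryTrace, h1, LinearMap.comp_zero, LinearMap.comp_zero, map_zero,
    mul_zero]

end Fintype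

end Exterior

/-- In the basis of wedge monomials indexed by `p`-subsets, the diagonal entry at `S` is the
principal minor on `S`. -/
lemma trace_extPowerAct_eq_sum_permMinor (n p : ℕ) (w : Perm (Fin n)) :
    LinearMap.trace ℂ _ (extPowerAct (α := Fin n) w p) =
      ∑ S ∈ Finset.univ.powersetCard p, permMinor S w := by
  classical
  let b := (Finsupp.basisSingleOne (R := ℂ) (ι := Fin n))
  rw [LinearMap.trace_eq_matrix_trace ℂ (b.exteriorPower p), Matrix.trace]
  rw [Finset.sum_subtype (p := (· ∈ Set.powersetCard (Fin n) p)) _ fun S => by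
    simp [Finset.mem_powersetCard, Set.powersetCard.mem_iff]]
  refine Finset.sum_congr rfl fun S _ => ?_
  rw [Matrix.diag_apply, LinearMap.toMatrix_apply, exteriorPower.basis_repr_apply,
    exteriorPower.basis_apply, exteriorPower.ιMulti_family]
  have h : extPowerAct w p (exteriorPower.ιMulti ℂ p
      (b ∘ Set.powersetCard.ofFinEmbEquiv.symm S)) = exteriorPower.ιMulti ℂ p
        fun i => Finsupp.single (w (Set.powersetCard.ofFinEmbEquiv.symm S i)) 1 := by
    refine Subtype.ext ?_
    refine (ExteriorAlgebra.map_apply_ιMulti _ _).trans ?_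
    refine congrArg (ExteriorAlgebra.ιMulti ℂ p) (funext fun i => ?_)
    simp [b]
  rw [h, exteriorPower.ιMultiDual_apply_ιMulti, permMinor,
    ← Matrix.det_submatrix_equiv_self (S.1.orderIsoOfFin S.2).toEquiv, ← Matrix.det_transpose]
  congr 1
  ext i j
  simp [b, Finsupp.single_apply, Set.powersetCard.ofFinEmbEquiv_symm_apply]
  rfl

/-! ## The Orlik-Solomon algebra of a uniform matroid -/

lemma uniformMatroid_indep_iff {n d : ℕ} {I : Set (Fin n)} :
    (uniformMatroid n d).Indep I ↔ I.ncard ≤ d := Iff.rfl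

lemma uniformMatroid_isCircuit_iff {n d : ℕ} {C : Set (Fin n)} :
    (uniformMatroid n d).IsCircuit C ↔ C.ncard = d + 1 := by
  rw [Matroid.isCircuit_iff_forall_ssubset, Matroid.dep_iff, uniformMatroid_indep_iff]
  constructor
  · rintro ⟨⟨h1, -⟩, h2⟩
    have hne : C.Nonempty := by
      rw [Set.nonempty_iff_ne_empty]
      rintro rfl
      simp at h1
    obtain ⟨a, ha⟩ := hne
    have h3 := uniformMatroid_indep_iff.1 (h2 (Set.sdiff_singleton_ssubset.2 ha))
    have h4 := Set.ncard_sdiff_singleton_add_one ha (Set.toFinite C)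
    omega
  · intro h
    refine ⟨⟨by omega, fun x _ => Set.mem_univ x⟩, fun I hI => uniformMatroid_indep_iff.2 ?_⟩
    have := Set.ncard_lt_ncard hI (Set.toFinite C)
    omega

lemma uniformMatroid_eRank_toNat (m d : ℕ) : (uniformMatroid (m + d) d).eRank.toNat = d := by
  obtain ⟨B, hB⟩ := (uniformMatroid (m + d) d).exists_isBase
  obtain ⟨S, -, hS⟩ := Finset.exists_subset_card_eq (s := (Finset.univ : Finset (Fin (m + d))))
    (n := d) (by simp)
  have hSi : (uniformMatroid (m + d) d).Indep S :=
    uniformMatroid_indep_iff.2 (by rw [Set.ncard_coe_finset, hS])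
  have h1 : B.ncard ≤ d := uniformMatroid_indep_iff.1 hB.indep
  have h2 := hSi.encard_le_eRank
  rw [← hB.encard_eq_eRank, Set.encard_coe_eq_coe_finsetCard, hS,
    ← (Set.toFinite B).cast_ncard_eq] at h2
  rw [← hB.encard_eq_eRank, ← (Set.toFinite B).cast_ncard_eq, ENat.toNat_natCast]
  exact le_antisymm h1 (by exact_mod_cast h2)

/-! ### The Orlik-Solomon ideal in degrees at most `d` -/

lemma prod_map_e_mem_exteriorPower {α : Type} (l : List α) :
    (l.map e).prod ∈ ⋀[ℂ]^l.length (α →₀ ℂ) := by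
  induction l with
  | nil =>
    simp only [List.map_nil, List.prod_nil, List.length_nil]
    exact SetLike.GradedOne.one_mem (A := fun i : ℕ => ⋀[ℂ]^i (α →₀ ℂ))
  | cons a l ih =>
    rw [List.map_cons, List.prod_cons, List.length_cons]
    exact ι_mul_mem_exteriorPower _ ih

/-- The elements whose components of degree less than `d` vanish and whose component of degree `d`
is a cycle for `∂`. -/
def leadingCycles (α : Type) (d : ℕ) : Submodule ℂ (Ext α) where
  carrier := {x | (∀ p < d,
      (DirectSum.decompose (fun i : ℕ => ⋀[ℂ]^i (α →₀ ℂ)) x p : Ext α) = 0) ∧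
    partialDer (DirectSum.decompose (fun i : ℕ => ⋀[ℂ]^i (α →₀ ℂ)) x d : Ext α) = 0}
  zero_mem' := by simp
  add_mem' := by
    rintro x y ⟨hx, hx'⟩ ⟨hy, hy'⟩
    simp only [Set.mem_ofPred_eq, DirectSum.decompose_add, DirectSum.add_apply, Submodule.coe_add,
      map_add]
    exact ⟨fun p hp => by rw [hx p hp, hy p hp, add_zero], by rw [hx', hy', add_zero]⟩
  smul_mem' := by
    rintro c x ⟨hx, hx'⟩
    simp only [Set.mem_ofPred_eq, DirectSum.decompose_smul, DirectSum.smul_apply,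
      Submodule.coe_smul, map_smul]
    exact ⟨fun p hp => by rw [hx p hp, smul_zero], by rw [hx', smul_zero]⟩

lemma mem_leadingCycles {α : Type} {d : ℕ} {x : Ext α} :
    x ∈ leadingCycles α d ↔ (∀ p < d,
      (DirectSum.decompose (fun i : ℕ => ⋀[ℂ]^i (α →₀ ℂ)) x p : Ext α) = 0) ∧
    partialDer (DirectSum.decompose (fun i : ℕ => ⋀[ℂ]^i (α →₀ ℂ)) x d : Ext α) = 0 := Iff.rfl

lemma ι_mem_exteriorPower_one {α : Type} (v : α →₀ ℂ) :
    ExteriorAlgebra.ι ℂ v ∈ ⋀[ℂ]^1 (α →₀ ℂ) := by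
  rw [ExteriorAlgebra.exteriorPower, pow_one]
  exact ⟨v, rfl⟩

/-- Multiplying by a vector raises degrees by one, so the components of degree at most `d` of the
product come from components of `x` of degree less than `d`, which vanish. Scalars are harmless, and
these generate the algebra. -/
lemma mul_mem_leadingCycles_left {α : Type} {d : ℕ} (y : Ext α) :
    ∀ x ∈ leadingCycles α d, y * x ∈ leadingCycles α d := by
  induction y using ExteriorAlgebra.induction with
  | algebraMap r =>
    intro x hx
    rw [← Algebra.smul_def]
    exact Submodule.smul_mem _ _ hx
  | ι v =>
    intro x hx
    rw [mem_leadingCycles] at hx ⊢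
    have hv := ι_mem_exteriorPower_one v
    constructor
    · intro p hp
      rw [DirectSum.coe_decompose_mul_of_left_mem (fun i : ℕ => ⋀[ℂ]^i (α →₀ ℂ)) p hv]
      split_ifs
      · rw [hx.1 _ (by omega), mul_zero]
      · rfl
    · rw [DirectSum.coe_decompose_mul_of_left_mem (fun i : ℕ => ⋀[ℂ]^i (α →₀ ℂ)) d hv]
      split_ifs
      · rw [hx.1 _ (by omega), mul_zero, map_zero]
      · rw [map_zero]
  | mul y z hy hz => intro x hx; rw [mul_assoc]; exact hy _ (hz x hx)
  | add y z hy hz => intro x hx; rw [add_mul]; exact Submodule.add_mem _ (hy x hx) (hz x hx)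

lemma mul_mem_leadingCycles_right {α : Type} {d : ℕ} (y : Ext α) :
    ∀ x ∈ leadingCycles α d, x * y ∈ leadingCycles α d := by
  induction y using ExteriorAlgebra.induction with
  | algebraMap r =>
    intro x hx
    rw [← Algebra.commutes, ← Algebra.smul_def]
    exact Submodule.smul_mem _ _ hx
  | ι v =>
    intro x hx
    rw [mem_leadingCycles] at hx ⊢
    have hv := ι_mem_exteriorPower_one v
    constructor
    · intro p hp
      rw [DirectSum.coe_decompose_mul_of_right_mem (fun i : ℕ => ⋀[ℂ]^i (α →₀ ℂ)) p hv]
      split_ifs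
      · rw [hx.1 _ (by omega), zero_mul]
      · rfl
    · rw [DirectSum.coe_decompose_mul_of_right_mem (fun i : ℕ => ⋀[ℂ]^i (α →₀ ℂ)) d hv]
      split_ifs
      · rw [hx.1 _ (by omega), zero_mul, map_zero]
      · rw [map_zero]
  | mul y z hy hz => intro x hx; rw [← mul_assoc]; exact hz _ (hy x hx)
  | add y z hy hz => intro x hx; rw [mul_add]; exact Submodule.add_mem _ (hy x hx) (hz x hx)

lemma length_of_isCircuit {n d : ℕ} {l : List (Fin n)} (hl : l.Nodup)
    (hc : (uniformMatroid n d).IsCircuit {i | i ∈ l}) : l.length = d + 1 := by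
  rw [uniformMatroid_isCircuit_iff, ← List.coe_toFinset, Set.ncard_coe_finset,
    List.toFinset_card_of_nodup hl] at hc
  exact hc

/-- The upper bound on the ideal: `leadingCycles` is a two-sided ideal, and it contains the
generators because they have degree `d` and `∂ ∂ = 0`. -/
lemma mem_leadingCycles_of_mem_osIdeal {n d : ℕ} {x : Ext (Fin n)}
    (hx : x ∈ osIdeal (uniformMatroid n d)) : x ∈ leadingCycles (Fin n) d := by
  let J : TwoSidedIdeal (Ext (Fin n)) := TwoSidedIdeal.mk' (leadingCycles (Fin n) d)
    (Submodule.zero_mem _) (fun hx hy => Submodule.add_mem _ hx hy)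
    (fun hx => Submodule.neg_mem _ hx) (fun {y _} hx => mul_mem_leadingCycles_left y _ hx)
    (fun {_ y} hx => mul_mem_leadingCycles_right y _ hx)
  have hJ : osIdeal (uniformMatroid n d) ≤ J := by
    refine TwoSidedIdeal.span_le.2 ?_
    rintro _ ⟨l, hl, hc, rfl⟩
    rw [SetLike.mem_coe, TwoSidedIdeal.mem_mk', SetLike.mem_coe, mem_leadingCycles]
    have hmem : partialDer (l.map e).prod ∈ ⋀[ℂ]^d (Fin n →₀ ℂ) := by
      refine partialDer_mem_exteriorPower d _ ?_
      rw [← length_of_isCircuit hl hc]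
      exact prod_map_e_mem_exteriorPower l
    constructor
    · intro p hp
      exact DirectSum.decompose_of_mem_ne (fun i : ℕ => ⋀[ℂ]^i (Fin n →₀ ℂ)) hmem (by omega)
    · rw [DirectSum.decompose_of_mem_same (fun i : ℕ => ⋀[ℂ]^i (Fin n →₀ ℂ)) hmem,
        partialDer_partialDer]
  exact (TwoSidedIdeal.mem_mk' _ _ _ _ _ _ _).1 (hJ hx)

lemma eq_zero_of_mem_osIdeal {n d p : ℕ} (hp : p < d) {x : Ext (Fin n)}
    (hx : x ∈ osIdeal (uniformMatroid n d)) (hxp : x ∈ ⋀[ℂ]^p (Fin n →₀ ℂ)) : x = 0 := by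
  have h := (mem_leadingCycles.1 (mem_leadingCycles_of_mem_osIdeal hx)).1 p hp
  rwa [DirectSum.decompose_of_mem_same (fun i : ℕ => ⋀[ℂ]^i (Fin n →₀ ℂ)) hxp] at h

lemma partialDer_eq_zero_of_mem_osIdeal {n d : ℕ} {x : Ext (Fin n)}
    (hx : x ∈ osIdeal (uniformMatroid n d)) (hxd : x ∈ ⋀[ℂ]^d (Fin n →₀ ℂ)) :
    partialDer x = 0 := by
  have h := (mem_leadingCycles.1 (mem_leadingCycles_of_mem_osIdeal hx)).2
  rwa [DirectSum.decompose_of_mem_same (fun i : ℕ => ⋀[ℂ]^i (Fin n →₀ ℂ)) hxd] at h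

/-- The matching lower bound. A wedge of `d + 1` basis vectors either has a repetition and vanishes,
or enumerates a circuit. -/
lemma partialDer_mem_osIdeal {n d : ℕ} {x : Ext (Fin n)}
    (hx : x ∈ ⋀[ℂ]^(d + 1) (Fin n →₀ ℂ)) :
    partialDer x ∈ (osIdeal (uniformMatroid n d)).asIdeal := by
  have hs : Submodule.span ℂ (Set.range fun i : Fin n => (Finsupp.single i 1 : Fin n →₀ ℂ)) = ⊤ := by
    rw [← (Finsupp.basisSingleOne (R := ℂ) (ι := Fin n)).span_eq]
    simp
  rw [← exteriorPower.ιMulti_span_fixedDegree_of_span_eq_top ℂ (d + 1) _ hs] at hx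
  induction hx using Submodule.span_induction with
  | zero => rw [map_zero]; exact Submodule.zero_mem _
  | add x y _ _ hx hy => rw [map_add]; exact Submodule.add_mem _ hx hy
  | smul c x _ hx =>
    rw [map_smul, Algebra.smul_def]
    exact Ideal.mul_mem_left _ _ hx
  | mem x hx =>
    obtain ⟨v, hv, rfl⟩ := hx
    choose f hf using fun i => hv (Set.mem_range_self i)
    by_cases hinj : Function.Injective f
    · refine TwoSidedIdeal.mem_asIdeal.2 (TwoSidedIdeal.subset_span
        ⟨List.ofFn f, List.nodup_ofFn.2 hinj, ?_, ?_⟩)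
      · rw [uniformMatroid_isCircuit_iff, ← List.coe_toFinset, Set.ncard_coe_finset,
          List.toFinset_card_of_nodup (List.nodup_ofFn.2 hinj), List.length_ofFn]
      · rw [ExteriorAlgebra.ιMulti_apply, List.map_ofFn]
        simp only [← hf]
        rfl
    · have hvi : ¬ Function.Injective v := by
        intro h
        refine hinj fun i j hij => h ?_
        rw [← hf i, ← hf j, hij]
      rw [AlternatingMap.map_eq_zero_of_not_injective _ _ hvi, map_zero]
      exact Submodule.zero_mem _

/-- The projection of an exterior power to the Orlik-Solomon algebra. -/
def osProj {α : Type} (M : Matroid α) (p : ℕ) : ⋀[ℂ]^p (α →₀ ℂ) →ₗ[ℂ] osDeg M p :=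
  (Ideal.Quotient.mkₐ ℂ (osIdeal M).asIdeal).toLinearMap.submoduleMap (⋀[ℂ]^p (α →₀ ℂ))

lemma osProj_surjective {α : Type} (M : Matroid α) (p : ℕ) : Function.Surjective (osProj M p) :=
  LinearMap.submoduleMap_surjective _ _

lemma osProj_eq_zero_iff {α : Type} (M : Matroid α) (p : ℕ) (x : ⋀[ℂ]^p (α →₀ ℂ)) :
    osProj M p x = 0 ↔ (x : Ext α) ∈ osIdeal M := by
  rw [← TwoSidedIdeal.mem_asIdeal, ← Ideal.Quotient.eq_zero_iff_mem, ← Submodule.coe_eq_zero]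
  rfl

lemma osProj_comp_extPowerAct {α W : Type} [Group W] [MulAction W α] (N : EquivariantMatroid W α)
    (w : W) (p : ℕ) :
    osProj N.M p ∘ₗ extPowerAct w p = N.osRep p w ∘ₗ osProj N.M p :=
  LinearMap.ext fun _ => rfl

lemma character_osRep_uniform_of_lt {m d p : ℕ} (hp : p < d) (w : Perm (Fin (m + d))) :
    ((uniform m d).osRep p).character w = LinearMap.trace ℂ _ (extPowerAct (α := Fin (m + d)) w p) := by
  rw [← LinearMap.comp_id (extPowerAct w p)]
  refine trace_eq_trace_comp_of_surjective (osProj_surjective _ p)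
    (osProj_comp_extPowerAct (uniform m d) w p) _ (LinearMap.comp_id _) fun x hx => ?_
  exact Subtype.ext (eq_zero_of_mem_osIdeal hp ((osProj_eq_zero_iff _ _ _).1 hx) x.2)

/-- In top degree the kernel of the projection is exactly `ker ∂`, so `koszulH ∘ koszulD` serves as
`Q` in `trace_eq_trace_comp_of_surjective`. -/
lemma character_osRep_uniform_top (m d : ℕ) (w : Perm (Fin (m + (d + 1)))) :
    ((uniform m (d + 1)).osRep (d + 1)).character w = boundaryTrace (Fin (m + (d + 1))) w d := by
  rw [← trace_extPowerAct_comp_koszulH_comp_koszulD]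
  refine trace_eq_trace_comp_of_surjective (osProj_surjective _ (d + 1))
    (osProj_comp_extPowerAct (uniform m (d + 1)) w (d + 1)) _ ?_ fun x hx => ?_
  · refine LinearMap.ext fun x => ?_
    have h := LinearMap.congr_fun (koszul_homotopy (α := Fin (m + (d + 1))) d) x
    -- By the homotopy, `x` and its image under `koszulH ∘ koszulD` differ by a boundary, which lies
    -- in the ideal.
    rw [LinearMap.add_apply, LinearMap.id_apply] at h
    conv_rhs => rw [← h, map_add]
    refine right_eq_add.2 ?_
    rw [osProj_eq_zero_iff]
    exact TwoSidedIdeal.mem_asIdeal.1 (partialDer_mem_osIdeal (Subtype.property _))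
  · have h := partialDer_eq_zero_of_mem_osIdeal ((osProj_eq_zero_iff _ _ _).1 hx) x.2
    have h' : koszulD (Fin (m + (d + 1))) d x = 0 := Subtype.ext h
    rw [LinearMap.comp_apply, h', map_zero]

/-! ## The Frobenius characteristic of the equivariant characteristic polynomial -/

lemma frobFun_trace_extPowerAct {n p : ℕ} (hp : p ≤ n) :
    frobFun n (fun w => LinearMap.trace ℂ _ (extPowerAct (α := Fin n) w p)) =
      elemSym p * schurRow (n - p) := by
  rw [← frobFun_sum_permMinor n p hp]
  exact congrArg _ (funext (trace_extPowerAct_eq_sum_permMinor n p))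

lemma frobFun_neg_one_pow_mul (n p : ℕ) (χ : Perm (Fin n) → ℂ) :
    frobFun n (fun w => (-1) ^ p * χ w) = (-1) ^ p * frobFun n χ := by
  have h : (fun w => (-1) ^ p * χ w) = ((-1 : ℂ) ^ p) • χ := rfl
  rw [h, map_smul, Algebra.smul_def, map_pow, map_neg, map_one]

lemma frobFun_sum_trace_extPowerAct {n d : ℕ} (hd : d ≤ n + 1) :
    frobFun n (fun w => ∑ p ∈ Finset.range d,
      (-1) ^ p * LinearMap.trace ℂ _ (extPowerAct (α := Fin n) w p)) =
      ∑ p ∈ Finset.range d, (-1) ^ p * (elemSym p * schurRow (n - p)) := by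
  have h : (fun w : Perm (Fin n) => ∑ p ∈ Finset.range d,
      (-1) ^ p * LinearMap.trace ℂ _ (extPowerAct (α := Fin n) w p)) =
      ∑ p ∈ Finset.range d, fun w =>
        (-1) ^ p * LinearMap.trace ℂ _ (extPowerAct (α := Fin n) w p) := by
    ext w
    rw [Finset.sum_apply]
  rw [h, map_sum]
  refine Finset.sum_congr rfl fun p hp => ?_
  rw [frobFun_neg_one_pow_mul,
    frobFun_trace_extPowerAct (by have := Finset.mem_range.1 hp; omega)]

/-- The Frobenius characteristic of the Euler characteristic of the exact Koszul complex. -/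
lemma sum_elemSym_mul_schurRow {n : ℕ} (hn : n ≠ 0) :
    ∑ p ∈ Finset.range (n + 1), (-1) ^ p * (elemSym p * schurRow (n - p)) = 0 := by
  have : Nonempty (Fin n) := ⟨⟨0, Nat.pos_of_ne_zero hn⟩⟩
  rw [← frobFun_sum_trace_extPowerAct le_rfl, ← map_zero (frobFun n)]
  congr 1
  ext w
  have h := sum_trace_extPowerAct_card (α := Fin n) w
  rwa [Fintype.card_fin] at h

lemma frobFun_zero_apply (χ : Perm (Fin 0) → ℂ) : frobFun 0 χ = algebraMap ℂ Sym (χ 1) := by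
  rw [frobFun_apply, Fintype.sum_unique, Algebra.algebraMap_eq_smul_one, cyclePowerSum]
  simp [Perm.parts_partition]

/-- The generating function `∑ (-1)ⁿ eₙ yⁿ`. -/
def elemSeries : PowerSeries Sym := PowerSeries.mk fun n => (-1) ^ n * elemSym n

lemma elemSeries_mul_sSeries : elemSeries * sSeries = 1 := by
  ext1 n
  rw [PowerSeries.coeff_mul, Finset.Nat.sum_antidiagonal_eq_sum_range_succ_mk, PowerSeries.coeff_one]
  simp only [elemSeries, sSeries, PowerSeries.coeff_mk, mul_assoc]
  split_ifs with hn
  · subst hn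
    simp [schurRow_eq, elemSym, frobFun_zero_apply]
  · exact sum_elemSym_mul_schurRow hn

lemma frob_zero (n : ℕ) : frob n 0 = 0 := (frobFun n).map_zero

lemma coeff_grFrob (n : ℕ) (P : (VRep (Perm (Fin n)))[X]) (i : ℕ) :
    (grFrob n P).coeff i = frob n (P.coeff i) := by
  rw [grFrob, Polynomial.sum_def, Polynomial.finsetSum_coeff]
  simp only [Polynomial.coeff_monomial]
  rw [Finset.sum_ite_eq']
  split_ifs with h
  · rfl
  · rw [Polynomial.notMem_support_iff.1 h, frob_zero]

lemma coeff_grFrob_charPoly_uniform (m d i : ℕ) :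
    (grFrob (m + d) (uniform m d).charPoly).coeff i = ∑ p ∈ Finset.range (d + 1),
      if d - p = i then (-1) ^ p * frobFun (m + d) ((uniform m d).osRep p).character else 0 := by
  have hr : (uniform m d).M.eRank.toNat = d := uniformMatroid_eRank_toNat m d
  rw [coeff_grFrob, EquivariantMatroid.charPoly, hr, Polynomial.finsetSum_coeff,
    frob_eq_frobFun, AddSubmonoidClass.coe_finsetSum, map_sum]
  refine Finset.sum_congr rfl fun p _ => ?_
  rw [Polynomial.coeff_monomial]
  split_ifs
  · exact frobFun_neg_one_pow_mul _ _ _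
  · exact map_zero _

lemma frobFun_character_osRep_uniform_top (m d : ℕ) :
    (-1) ^ (d + 1) * frobFun (m + (d + 1)) ((uniform m (d + 1)).osRep (d + 1)).character =
      -∑ p ∈ Finset.range (d + 1), (-1) ^ p * (elemSym p * schurRow (m + (d + 1) - p)) := by
  rw [← frobFun_sum_trace_extPowerAct (by omega), ← map_neg, ← frobFun_neg_one_pow_mul]
  congr 1
  ext w
  rw [Pi.neg_apply, sum_trace_extPowerAct, character_osRep_uniform_top]
  ring

/-- The top degree part contributes only to `t^0`, and there it is minus the sum of the terms with
`p < d`. Pairing term by term yields the factor `t^{d-p} - 1`. -/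
lemma coeff_grFrob_charPoly_uniform_eq_sum (m d i : ℕ) (hd : 1 ≤ d) :
    (grFrob (m + d) (uniform m d).charPoly).coeff i = ∑ p ∈ Finset.range d,
      (-1) ^ p * elemSym p * ((if i = d - p then schurRow (m + (d - p)) else 0) -
        (if i = 0 then schurRow (m + (d - p)) else 0)) := by
  obtain ⟨d, rfl⟩ := Nat.exists_eq_add_of_le' hd
  rw [coeff_grFrob_charPoly_uniform, Finset.sum_range_succ, frobFun_character_osRep_uniform_top,
    Nat.sub_self]
  have h : ∀ x : Sym, (if 0 = i then -x else 0) = -(if i = 0 then x else 0) := by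
    intro x
    split_ifs <;> first | rfl | omega | simp
  have h' : ∀ f : ℕ → Sym, (if i = 0 then ∑ p ∈ Finset.range (d + 1), f p else 0) =
      ∑ p ∈ Finset.range (d + 1), if i = 0 then f p else 0 := by
    intro f
    split_ifs <;> simp
  rw [h, h', ← sub_eq_add_neg, ← Finset.sum_sub_distrib]
  refine Finset.sum_congr rfl fun p hp => ?_
  have hp := Finset.mem_range.1 hp
  have hchar : frobFun (m + (d + 1)) ((uniform m (d + 1)).osRep p).character =
      elemSym p * schurRow (m + (d + 1 - p)) := by
    rw [← Nat.add_sub_assoc hp.le, ← frobFun_trace_extPowerAct (by omega)]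
    exact congrArg _ (funext (character_osRep_uniform_of_lt hp))
  rw [hchar, ← Nat.add_sub_assoc hp.le, mul_sub, mul_ite, mul_ite, mul_zero, mul_assoc]
  simp only [eq_comm (a := i)]

/-! ## Generating functions -/

/-- `∑ s[k + m] (t u)ᵏ xᵐ`. -/
def schurTU : GenRing := fun a => if a 0 = a 1 then schurRow (a 2 + a 1) else 0

/-- `∑ s[k + m] uᵏ xᵐ`. -/
def schurU : GenRing := fun a => if a 0 = 0 then schurRow (a 2 + a 1) else 0

lemma hasSubst_uVar : PowerSeries.HasSubst uVar := PowerSeries.HasSubst.X 1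

lemma hasSubst_tVar_mul_uVar : PowerSeries.HasSubst (tVar * uVar) :=
  PowerSeries.HasSubst.of_constantCoeff_zero (by simp [tVar])

lemma elemSeries_subst_mul_s : elemSeries.subst uVar * s uVar = 1 := by
  rw [s, ← PowerSeries.subst_mul hasSubst_uVar, elemSeries_mul_sSeries,
    ← PowerSeries.coe_substAlgHom hasSubst_uVar, map_one]

lemma coeff_X_mul_eq_ite {σ R : Type*} [CommSemiring R] (i : σ) (f : MvPowerSeries σ R)
    (a : σ →₀ ℕ) : MvPowerSeries.coeff a (MvPowerSeries.X i * f) =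
      if 1 ≤ a i then MvPowerSeries.coeff (a - Finsupp.single i 1) f else 0 := by
  classical
  rw [MvPowerSeries.X, MvPowerSeries.coeff_monomial_mul, one_mul]
  simp only [Finsupp.single_le_iff]

lemma coeff_elemSeries_subst_mul (f : GenRing) (a : Fin 3 →₀ ℕ) :
    MvPowerSeries.coeff a (elemSeries.subst uVar * f) = ∑ p ∈ Finset.range (a 1 + 1),
      (-1) ^ p * elemSym p * MvPowerSeries.coeff (a - Finsupp.single 1 p) f := by
  classical
  rw [MvPowerSeries.coeff_mul]
  symm
  refine Finset.sum_of_injOn (fun p => (Finsupp.single 1 p, a - Finsupp.single 1 p)) ?_ ?_ ?_ ?_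
  · intro p _ q _ h
    exact Finsupp.single_injective 1 (congrArg Prod.fst h)
  · intro p hp
    have hp : p ≤ a 1 := Nat.lt_succ_iff.1 (by simpa using hp)
    simp only [Finset.mem_coe, Finset.HasAntidiagonal.mem_antidiagonal]
    exact add_tsub_cancel_of_le (Finsupp.single_le_iff.2 hp)
  · rintro ⟨b, c⟩ hbc hn
    rw [uVar, PowerSeries.coeff_subst_single, if_neg, zero_mul]
    intro hb
    refine hn ⟨b 1, ?_, ?_⟩
    · have := Finset.HasAntidiagonal.mem_antidiagonal.1 hbc
      simp only [← this, Finset.coe_range, Set.mem_Iio, Finsupp.add_apply]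
      omega
    · have := Finset.HasAntidiagonal.mem_antidiagonal.1 hbc
      simp only [← hb, ← this, add_tsub_cancel_left]
  · intro p _
    rw [uVar, PowerSeries.coeff_subst_single]
    simp [elemSeries]

lemma coeff_schurTU (a : Fin 3 →₀ ℕ) : MvPowerSeries.coeff a schurTU =
    if a 0 = a 1 then schurRow (a 2 + a 1) else 0 := rfl

lemma coeff_schurU (a : Fin 3 →₀ ℕ) : MvPowerSeries.coeff a schurU =
    if a 0 = 0 then schurRow (a 2 + a 1) else 0 := rfl

lemma genH_eq : genH = elemSeries.subst uVar * (schurTU - schurU) := by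
  ext1 a
  -- The last term `p = a 1` drops out since `schurTU` and `schurU` agree at `u^0`. This leaves the
  -- range `p < d`, and `0` when `d = 0`.
  rw [coeff_elemSeries_subst_mul, Finset.sum_range_succ]
  change (if 1 ≤ a 1 then _ else _) = _
  simp only [map_sub, coeff_schurTU, coeff_schurU, Finsupp.tsub_apply, Finsupp.single_apply]
  simp only [Fin.isValue, one_ne_zero, ↓reduceIte, tsub_zero, Fin.reduceEq, tsub_self, sub_self,
    mul_zero, add_zero]
  by_cases h : 1 ≤ a 1
  · rw [if_pos h]
    exact coeff_grFrob_charPoly_uniform_eq_sum _ _ _ h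
  · rw [if_neg h, Nat.lt_one_iff.1 (not_le.1 h), Finset.range_zero, Finset.sum_empty]

lemma coeff_s_uVar (a : Fin 3 →₀ ℕ) :
    MvPowerSeries.coeff a (s uVar) = if a 0 = 0 ∧ a 2 = 0 then schurRow (a 1) else 0 := by
  rw [s, uVar, PowerSeries.coeff_subst_single]
  simp [DFunLike.ext_iff, Fin.forall_fin_succ, sSeries]

lemma coeff_s_xVar (a : Fin 3 →₀ ℕ) :
    MvPowerSeries.coeff a (s xVar) = if a 0 = 0 ∧ a 1 = 0 then schurRow (a 2) else 0 := by
  rw [s, xVar, PowerSeries.coeff_subst_single]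
  simp [DFunLike.ext_iff, Fin.forall_fin_succ, sSeries]

lemma coeff_s_tVar_mul_uVar (a : Fin 3 →₀ ℕ) :
    MvPowerSeries.coeff a (s (tVar * uVar)) =
      if a 0 = a 1 ∧ a 2 = 0 then schurRow (a 1) else 0 := by
  have h : ∀ k : ℕ, MvPowerSeries.coeff a ((tVar * uVar) ^ k) =
      if a 0 = k ∧ a 1 = k ∧ a 2 = 0 then 1 else 0 := by
    intro k
    classical
    rw [tVar, uVar, mul_pow, MvPowerSeries.X_pow_eq, MvPowerSeries.X_pow_eq,
      MvPowerSeries.monomial_mul_monomial, MvPowerSeries.coeff_monomial, one_mul]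
    simp [DFunLike.ext_iff, Fin.forall_fin_succ]
  rw [s, PowerSeries.coeff_subst hasSubst_tVar_mul_uVar, finsum_eq_single _ (a 1)]
  · rw [h]
    simp [sSeries]
  · intro k hk
    rw [h, if_neg (by omega), smul_zero]

lemma coeff_tVar_mul (f : GenRing) (a : Fin 3 →₀ ℕ) : MvPowerSeries.coeff a (tVar * f) =
    if 1 ≤ a 0 then MvPowerSeries.coeff (a - Finsupp.single 0 1) f else 0 :=
  coeff_X_mul_eq_ite 0 f a

lemma coeff_uVar_mul (f : GenRing) (a : Fin 3 →₀ ℕ) : MvPowerSeries.coeff a (uVar * f) =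
    if 1 ≤ a 1 then MvPowerSeries.coeff (a - Finsupp.single 1 1) f else 0 :=
  coeff_X_mul_eq_ite 1 f a

lemma coeff_xVar_mul (f : GenRing) (a : Fin 3 →₀ ℕ) : MvPowerSeries.coeff a (xVar * f) =
    if 1 ≤ a 2 then MvPowerSeries.coeff (a - Finsupp.single 2 1) f else 0 :=
  coeff_X_mul_eq_ite 2 f a

/-- Coefficients depend only on `k + m`, so multiplying by `tu` and by `x` gives the same result at
`(tu)^k x^m` when `k, m ≥ 1`. Only the terms with `m = 0` or `k = 0` survive. -/
lemma sub_mul_schurTU :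
    (tVar * uVar - xVar) * schurTU = tVar * uVar * s (tVar * uVar) - xVar * s xVar := by
  ext1 a
  rw [sub_mul, mul_assoc, mul_assoc, map_sub, map_sub]
  simp only [coeff_tVar_mul, coeff_uVar_mul, coeff_xVar_mul, coeff_s_tVar_mul_uVar, coeff_s_xVar,
    coeff_schurTU, Finsupp.tsub_apply, Finsupp.single_apply]
  generalize a 0 = i, a 1 = j, a 2 = k
  simp only [Fin.isValue, one_ne_zero, zero_ne_one, ↓reduceIte, tsub_zero, Fin.reduceEq]
  rcases i with _ | i <;> rcases j with _ | j <;> rcases k with _ | k <;>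
    simp [add_right_comm, ← add_assoc]

lemma sub_mul_schurU : (uVar - xVar) * schurU = uVar * s uVar - xVar * s xVar := by
  ext1 a
  rw [sub_mul, map_sub, map_sub]
  simp only [coeff_uVar_mul, coeff_xVar_mul, coeff_s_uVar, coeff_s_xVar,
    coeff_schurU, Finsupp.tsub_apply, Finsupp.single_apply]
  generalize a 0 = i, a 1 = j, a 2 = k
  simp only [Fin.isValue, one_ne_zero, ↓reduceIte, tsub_zero, Fin.reduceEq]
  rcases i with _ | i <;> rcases j with _ | j <;> rcases k with _ | k <;>
    simp [add_right_comm, ← add_assoc]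

lemma s_mul_genH : s uVar * genH = schurTU - schurU := by
  rw [genH_eq, ← mul_assoc, mul_comm (s uVar), elemSeries_subst_mul_s, one_mul]

lemma s_uVar_ne_zero : s uVar ≠ 0 := right_ne_zero_of_mul_eq_one elemSeries_subst_mul_s

lemma uVar_ne_zero : uVar ≠ 0 := by
  intro h
  have := congrArg (MvPowerSeries.coeff (Finsupp.single 1 1)) h
  simp [uVar] at this

lemma tVar_ne_zero : tVar ≠ 0 := by
  intro h
  have := congrArg (MvPowerSeries.coeff (Finsupp.single 0 1)) h
  simp [tVar] at this

lemma uVar_sub_xVar_ne_zero : uVar - xVar ≠ 0 := by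
  classical
  intro h
  have := congrArg (MvPowerSeries.coeff (Finsupp.single 1 1)) h
  simp [uVar, xVar, MvPowerSeries.coeff_X, Finsupp.single_left_inj] at this

lemma tVar_mul_uVar_sub_xVar_ne_zero : tVar * uVar - xVar ≠ 0 := by
  classical
  intro h
  have := congrArg (MvPowerSeries.coeff (Finsupp.single 2 1)) h
  rw [map_sub, coeff_tVar_mul] at this
  simp [xVar] at this

/-! ### The specialization `x = 0` -/

lemma hasSubst_x_zero : MvPowerSeries.HasSubst ![tVar, uVar, 0] := by
  refine MvPowerSeries.hasSubst_of_constantCoeff_zero fun i => ?_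
  fin_cases i <;> simp [tVar, uVar]

/-- The substitution `x = 0`. -/
def substXZero : GenRing →ₐ[Sym] GenRing := MvPowerSeries.substAlgHom hasSubst_x_zero

lemma substXZero_genH : substXZero genH = genHZero := by
  rw [substXZero, MvPowerSeries.coe_substAlgHom, genHZero]

lemma substXZero_tVar : substXZero tVar = tVar :=
  MvPowerSeries.substAlgHom_X hasSubst_x_zero 0

lemma substXZero_uVar : substXZero uVar = uVar :=
  MvPowerSeries.substAlgHom_X hasSubst_x_zero 1

lemma substXZero_xVar : substXZero xVar = 0 :=
  MvPowerSeries.substAlgHom_X hasSubst_x_zero 2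

lemma substXZero_s {a : GenRing} (ha : PowerSeries.HasSubst a) :
    substXZero (s a) = s (substXZero a) := by
  rw [substXZero, MvPowerSeries.coe_substAlgHom, s, s, PowerSeries.subst, PowerSeries.subst,
    MvPowerSeries.subst_comp_subst_apply ha.const hasSubst_x_zero]

lemma s_mul_genHZero : s uVar * genHZero = s (tVar * uVar) - s uVar := by
  have h1 := congrArg substXZero s_mul_genH
  have h2 := congrArg substXZero sub_mul_schurTU
  have h3 := congrArg substXZero sub_mul_schurU
  simp only [map_mul, map_sub, substXZero_genH, substXZero_s hasSubst_uVar,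
    substXZero_s hasSubst_tVar_mul_uVar, substXZero_tVar, substXZero_uVar, substXZero_xVar,
    zero_mul, sub_zero] at h1 h2 h3
  -- At `x = 0` the two closed forms carry common factors `tu` and `u`, which cancel in the domain.
  rw [h1, mul_left_cancel₀ (mul_ne_zero tVar_ne_zero uVar_ne_zero) h2,
    mul_left_cancel₀ uVar_ne_zero h3]

lemma toFrac_ne_zero {a : GenRing} (ha : a ≠ 0) : toFrac a ≠ 0 :=
  (map_ne_zero_iff _ (IsFractionRing.injective GenRing FracRing)).2 ha

end EqKL

end

theorem proposition3p6 :
    (letI t : EqKL.FracRing := EqKL.toFrac EqKL.tVar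
     letI u : EqKL.FracRing := EqKL.toFrac EqKL.uVar
     letI x : EqKL.FracRing := EqKL.toFrac EqKL.xVar
     letI sx : EqKL.FracRing := EqKL.toFrac (EqKL.s EqKL.xVar)
     letI su : EqKL.FracRing := EqKL.toFrac (EqKL.s EqKL.uVar)
     letI stu : EqKL.FracRing := EqKL.toFrac (EqKL.s (EqKL.tVar * EqKL.uVar))
     EqKL.toFrac EqKL.genH =
        u / (u - x) * (-1 + sx / su) + t * u / (t * u - x) * (stu / su - sx / su) ∧
      1 + EqKL.toFrac EqKL.genHZero = stu / su) := by
  have hs := EqKL.toFrac_ne_zero EqKL.s_uVar_ne_zero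
  have hu := EqKL.toFrac_ne_zero EqKL.uVar_sub_xVar_ne_zero
  have ht := EqKL.toFrac_ne_zero EqKL.tVar_mul_uVar_sub_xVar_ne_zero
  have h1 := congrArg EqKL.toFrac EqKL.s_mul_genH
  have h2 := congrArg EqKL.toFrac EqKL.sub_mul_schurTU
  have h3 := congrArg EqKL.toFrac EqKL.sub_mul_schurU
  have h4 := congrArg EqKL.toFrac EqKL.s_mul_genHZero
  simp only [map_sub, map_mul] at hu ht h1 h2 h3 h4
  generalize EqKL.toFrac (EqKL.s (EqKL.tVar * EqKL.uVar)) = stu at *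
  generalize EqKL.toFrac (EqKL.s EqKL.uVar) = su at *
  generalize EqKL.toFrac (EqKL.s EqKL.xVar) = sx at *
  generalize EqKL.toFrac EqKL.tVar = t at *
  generalize EqKL.toFrac EqKL.uVar = u at *
  generalize EqKL.toFrac EqKL.xVar = x at *
  generalize EqKL.toFrac EqKL.genH = G at *
  generalize EqKL.toFrac EqKL.genHZero = G₀ at *
  generalize EqKL.toFrac EqKL.schurTU = A at *
  generalize EqKL.toFrac EqKL.schurU = B at *
  constructor
  · have ht' : u * t - x ≠ 0 := by rwa [mul_comm]
    field_simp
    -- `s(u) 𝓗 = A - B` is multiplied by both denominators, and `h2`, `h3` then eliminate `A` and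
    -- `B`.
    linear_combination (t * u - x) * (u - x) * h1 + (u - x) * h2 - (t * u - x) * h3
  · rw [eq_div_iff hs]
    linear_combination h4
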